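/- All Banach spaces are real. For a Banach space $X$ let $B_X$, $S_X$ be its closed unit ball and unit sphere and $X^*$ its dual. A point $x\in S_X$ is a *Daugavet point* if for all $x^*\in S_{X^*}$ and $\alpha>0$ one has $\sup\{\|x-y\| : y\in B_X,\ x^*(y)>1-\alpha\}=2$. A functional $f\in S_{X^*}$ is a *weak$^*$ Daugavet point* if for all $x\in S_X$ and $\alpha>0$ one has $\sup\{\|f-g\| : g\in B_{X^*},\ g(x)>1-\alpha\}=2$. A sequence $(e_n)_{n\in\mathbb N}$ in $X$ is a *complemented unconditional basic sequence* if it is an unconditional Schauder basis of its closed linear span and this closed linear span is the range of a bounded linear projection on $X$. **Theorem.** Let $X$ be an infinite dimensional Banach space that contains a complemented unconditional basic sequence. Then there is an equivalent norm $|||\cdot|||$ on $X$ such that the space $(X,|||\cdot|||)$ has a Daugavet point and its dual, with the dual norm of $|||\cdot|||$, has a weak$^*$ Daugavet point. -/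

import Mathlib

universe u

noncomputable section

/-- The slice `S(f, α) = {y ∈ B_X : f y > 1 - α}` of the closed unit ball. -/
def ballSlice {X : Type u} [NormedAddCommGroup X] [NormedSpace ℝ X]
    (f : StrongDual ℝ X) (α : ℝ) : Set X :=
  {y | ‖y‖ ≤ 1 ∧ 1 - α < f y}

/-- The weak* slice `{g ∈ B_{X*} : g x > 1 - α}` of the closed dual unit ball. -/
def weakStarSlice {X : Type u} [NormedAddCommGroup X] [NormedSpace ℝ X]
    (x : X) (α : ℝ) : Set (StrongDual ℝ X) :=
  {g | ‖g‖ ≤ 1 ∧ 1 - α < g x}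

/-- `x` is a Daugavet point: `x` lies on the unit sphere, and `sup_{y ∈ S} ‖x - y‖ = 2` for every
slice `S` of the closed unit ball. -/
def IsDaugavetPoint {X : Type u} [NormedAddCommGroup X] [NormedSpace ℝ X] (x : X) : Prop :=
  ‖x‖ = 1 ∧ ∀ f : StrongDual ℝ X, ‖f‖ = 1 → ∀ α : ℝ, 0 < α →
    IsLUB ((fun y : X => ‖x - y‖) '' ballSlice f α) 2

/-- `f ∈ X*` is a weak* Daugavet point: `f` lies on the dual unit sphere, and
`sup_{g ∈ S} ‖f - g‖ = 2` for every weak* slice `S` of the closed dual unit ball. -/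
def IsWeakStarDaugavetPoint {X : Type u} [NormedAddCommGroup X] [NormedSpace ℝ X]
    (f : StrongDual ℝ X) : Prop :=
  ‖f‖ = 1 ∧ ∀ x : X, ‖x‖ = 1 → ∀ α : ℝ, 0 < α →
    IsLUB ((fun g : StrongDual ℝ X => ‖f - g‖) '' weakStarSlice x α) 2

/-- `e` is an unconditional basic sequence: it is an unconditional Schauder basis of its closed
linear span. -/
def IsUnconditionalBasicSequence {X : Type u} [NormedAddCommGroup X] [NormedSpace ℝ X]
    (e : ℕ → X) : Prop :=
  ∃ b : UnconditionalSchauderBasis ℕ ℝ (Submodule.span ℝ (Set.range e)).topologicalClosure,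
    ∀ n : ℕ, (b.basis n : X) = e n

/-- An equivalent norm on the normed space `X`. -/
structure EquivNorm (X : Type u) [NormedAddCommGroup X] [NormedSpace ℝ X] where
  /-- the new norm, as a seminorm; it is definite by the lower bound -/
  toSeminorm : Seminorm ℝ X
  equiv : ∃ c C : ℝ, 0 < c ∧ 0 < C ∧
    ∀ x : X, c * ‖x‖ ≤ toSeminorm x ∧ toSeminorm x ≤ C * ‖x‖

namespace EquivNorm

variable {X : Type u} [NormedAddCommGroup X] [NormedSpace ℝ X]

/-- The vector space `X` endowed with the equivalent norm `N` (a type synonym of `X`). -/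
def Space (_N : EquivNorm X) : Type u := X

instance instAddCommGroupSpace (N : EquivNorm X) : AddCommGroup N.Space :=
  inferInstanceAs (AddCommGroup X)

instance instModuleSpace (N : EquivNorm X) : Module ℝ N.Space :=
  inferInstanceAs (Module ℝ X)

instance instNormSpace (N : EquivNorm X) : Norm N.Space :=
  ⟨fun x => N.toSeminorm (x : X)⟩

theorem core (N : EquivNorm X) : NormedSpace.Core ℝ N.Space where
  norm_nonneg x := apply_nonneg N.toSeminorm (x : X)
  norm_smul c x := map_smul_eq_mul N.toSeminorm c (x : X)
  norm_triangle x y := map_add_le_add N.toSeminorm (x : X) (y : X)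
  norm_eq_zero_iff x := by
    constructor
    · intro h
      obtain ⟨c, C, hc, -, hcC⟩ := N.equiv
      have h1 : c * ‖(show X from x)‖ ≤ 0 := (hcC x).1.trans (le_of_eq h)
      have h2 : ‖(show X from x)‖ ≤ 0 := by
        by_contra! h3
        exact absurd h1 (not_le.mpr (mul_pos hc h3))
      exact norm_le_zero_iff.mp h2
    · intro h
      subst h
      exact map_zero N.toSeminorm

instance instNormedAddCommGroupSpace (N : EquivNorm X) : NormedAddCommGroup N.Space :=
  NormedAddCommGroup.ofCore N.core

instance instNormedSpaceSpace (N : EquivNorm X) : NormedSpace ℝ N.Space :=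
  NormedSpace.ofCore N.core

end EquivNorm

end

/-!
A complemented unconditional basic sequence yields a normalised sequence `e n` with biorthogonal
functionals `c n` on all of `X` and uniformly bounded coordinate projections `P A`
(`UnconditionalSystem`). Splitting the sequence into its even and odd terms splits `X` as
`ker Q ⊕ range Q` with `Q = P {odd}`. If `ker Q` is renormed to have a Daugavet point and `range Q`
to have a weak* Daugavet point in its dual, then the `ℓ¹`-sum of the two norms has both
(`exists_equivNorm_of_generating`).

*Daugavet point.* Let `x = e 0` and `p = c 0`. The new unit ball is the closed absolutely convex hull
of a bounded set `D` of vectors `w` with `p w = 1` on which given functionals `φ j`, vanishing at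
`x`, take values in `[0, 2]`, some `φ j w` being equal to `2`. A slice of the ball meets `D` or `-D`.
The functional `p - φ j` has norm at most `1` and takes the values `1` at `x` and `-1` at `w`, so `w`
has distance `2` from `x`; so has `-w`, because `p` takes the value `1` at both `x` and `w`. It remains
to choose the `φ j` so that the hull of `D` has interior points and contains `x`, that is, so that `x`
and `x + u`, for enough small `u`, are weakly approximable by points of `D`.

* If every functional is arbitrarily small on some `e n`, take `φ j = c (j + 1)`. For `u ≥ 0` small,
  the points `x + u + (2 - c n u) • e n` lie in `D` and approximate `x + u`; by unconditionality the
  positive cone is generating (`exists_isDaugavetGenerating_of_small`).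
* Otherwise some `f₀` is bounded away from zero on the sequence, which is then an `ℓ¹`-basis. After
  rescaling, `f₀ (e n) = 1`, and the tails `φ j = f₀ ∘ P (j, ∞)` work with perturbations
  `2 • (e t - e s)`, where a given functional almost agrees at `e s` and `e t`
  (`exists_isDaugavetGenerating_of_large`).

*Weak\* Daugavet point.* The construction of the first case is carried out in the dual, with the roles
of `e n` and `c n` exchanged. As `c n` is always weak* null, no case distinction is needed
(`exists_isWeakStarDaugavetGenerating`).

Hulls and gauges are avoided: the new norms are suprema over sets of functionals, and membership in a
hull is expressed by inequalities between functionals.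
-/

open Filter Topology

/-! ### Complemented unconditional systems -/

/-- A normalised sequence `e` in `X` with biorthogonal functionals `c` defined on all of `X`,
together with, for each set `A` of indices, the bounded operator `P A : x ↦ ∑_{n ∈ A} c n x • e n`,
the series converging unconditionally and the operators being uniformly bounded. This is what a
complemented unconditional basic sequence provides: `P univ` is a projection of `X` onto its closed
linear span. -/
structure UnconditionalSystem (X : Type*) [NormedAddCommGroup X] [NormedSpace ℝ X] where
  /-- the basic sequence -/
  e : ℕ → X
  /-- the coordinate functionals, extended to the whole space -/
  c : ℕ → StrongDual ℝ X
  /-- the coordinate projections -/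
  P : Set ℕ → X →L[ℝ] X
  /-- a bound for the norms of the coordinate projections -/
  K : ℝ
  ortho : ∀ m n, c m (e n) = if m = n then 1 else 0
  norm_e : ∀ n, ‖e n‖ = 1
  norm_P : ∀ A, ‖P A‖ ≤ K
  hasSum_P : ∀ A x, HasSum (A.indicator fun n => c n x • e n) (P A x)

namespace UnconditionalSystem

variable {X : Type*} [NormedAddCommGroup X] [NormedSpace ℝ X] (S : UnconditionalSystem X)

theorem K_nonneg : 0 ≤ S.K := (norm_nonneg _).trans (S.norm_P ∅)

theorem ortho_self (n : ℕ) : S.c n (S.e n) = 1 := by simp [S.ortho]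

theorem ortho_ne {m n : ℕ} (h : m ≠ n) : S.c m (S.e n) = 0 := by simp [S.ortho, h]

theorem norm_P_apply_le (A : Set ℕ) (x : X) : ‖S.P A x‖ ≤ S.K * ‖x‖ :=
  (S.P A).le_of_opNorm_le (S.norm_P A) x

theorem hasSum_apply_P (f : StrongDual ℝ X) (A : Set ℕ) (x : X) :
    HasSum (A.indicator fun n => S.c n x * f (S.e n)) (f (S.P A x)) := by
  have h : (A.indicator fun n => S.c n x * f (S.e n)) =
      fun n => f (A.indicator (fun n => S.c n x • S.e n) n) := by
    funext n
    by_cases hn : n ∈ A <;> simp [hn]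
  rw [h]
  exact (S.hasSum_P A x).mapL f

theorem c_P (m : ℕ) (A : Set ℕ) (x : X) : S.c m (S.P A x) = A.indicator (fun n => S.c n x) m := by
  refine (S.hasSum_apply_P (S.c m) A x).unique ?_
  convert hasSum_ite_eq m (A.indicator (fun n => S.c n x) m) using 1
  ext n
  by_cases hnm : n = m
  · subst hnm
    by_cases hn : n ∈ A <;> simp [hn, S.ortho]
  · by_cases hn : n ∈ A <;> simp [hn, hnm, S.ortho, Ne.symm hnm]

theorem P_eq_of_indicator_eq {A B : Set ℕ} {x y : X}
    (h : ∀ n, A.indicator (fun n => S.c n x) n = B.indicator (fun n => S.c n y) n) :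
    S.P A x = S.P B y := by
  refine (S.hasSum_P A x).unique ?_
  convert S.hasSum_P B y using 1
  ext n
  have hind (C : Set ℕ) (z : X) : C.indicator (fun n => S.c n z • S.e n) n =
      C.indicator (fun n => S.c n z) n • S.e n := by
    by_cases hn : n ∈ C <;> simp [hn]
  rw [hind, hind, h]

theorem P_e_of_mem {n : ℕ} {A : Set ℕ} (h : n ∈ A) : S.P A (S.e n) = S.e n := by
  refine (S.hasSum_P A _).unique ?_
  convert hasSum_ite_eq n (S.e n) using 1
  ext m
  by_cases hmn : m = n
  · subst hmn; simp [h, S.ortho]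
  · by_cases hm : m ∈ A <;> simp [hm, hmn, S.ortho]

theorem P_e_of_notMem {n : ℕ} {A : Set ℕ} (h : n ∉ A) : S.P A (S.e n) = 0 := by
  refine (S.hasSum_P A _).unique ?_
  convert hasSum_zero using 1
  ext m
  by_cases hmn : m = n
  · subst hmn; simp [h]
  · by_cases hm : m ∈ A <;> simp [hm, hmn, S.ortho]

theorem P_P_self (A : Set ℕ) (x : X) : S.P A (S.P A x) = S.P A x := by
  refine S.P_eq_of_indicator_eq fun n => ?_
  by_cases hn : n ∈ A <;> simp [hn, S.c_P]

theorem norm_c_apply_le (n : ℕ) (x : X) : |S.c n x| ≤ S.K * ‖x‖ := by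
  have h : S.P {n} x = S.c n x • S.e n := by
    refine (S.hasSum_P {n} x).unique ?_
    convert hasSum_ite_eq n (S.c n x • S.e n) using 1
    ext m
    by_cases hmn : m = n
    · subst hmn; simp
    · simp [hmn]
  have := S.norm_P_apply_le {n} x
  rwa [h, norm_smul, S.norm_e, mul_one, Real.norm_eq_abs] at this

theorem norm_c_le (n : ℕ) : ‖S.c n‖ ≤ S.K :=
  ContinuousLinearMap.opNorm_le_bound _ S.K_nonneg fun x => S.norm_c_apply_le n x

theorem tendsto_c (x : X) : Tendsto (fun n => S.c n x) atTop (𝓝 0) := by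
  have h := (S.hasSum_P Set.univ x).summable.tendsto_atTop_zero
  rw [tendsto_zero_iff_norm_tendsto_zero] at h ⊢
  simpa [norm_smul, S.norm_e] using h

/-- The subsystem along an injective selection of indices. -/
def comp (ι : ℕ → ℕ) (hι : Function.Injective ι) : UnconditionalSystem X where
  e n := S.e (ι n)
  c n := S.c (ι n)
  P A := S.P (ι '' A)
  K := S.K
  ortho m n := by simp [S.ortho, hι.eq_iff]
  norm_e n := S.norm_e _
  norm_P A := S.norm_P _
  hasSum_P A x := by
    convert (hι.hasSum_iff ?_).2 (S.hasSum_P (ι '' A) x) using 1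
    · ext n
      by_cases hn : n ∈ A <;> simp [hn, hι.eq_iff]
    · intro m hm
      exact Set.indicator_of_notMem (fun h => hm (Set.image_subset_range _ _ h)) _

end UnconditionalSystem

/-- The coordinate projections of an unconditional basis onto arbitrary sets of indices. -/
theorem UnconditionalSchauderBasis.exists_norm_tsum_indicator_le {Y : Type*}
    [NormedAddCommGroup Y] [NormedSpace ℝ Y] [CompleteSpace Y]
    (b : UnconditionalSchauderBasis ℕ ℝ Y) :
    ∃ K : ℝ, ∀ (A : Set ℕ) (y : Y), ‖∑' n, A.indicator (fun n => b.coord n y • b n) n‖ ≤ K * ‖y‖ := by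
  classical
  obtain ⟨K, hK⟩ := b.exists_norm_proj_le
  refine ⟨K, fun A y => ?_⟩
  have hs := ((b.expansion y).summable.indicator A).hasSum
  refine le_of_tendsto hs.norm (Eventually.of_forall fun F => ?_)
  have : ∑ n ∈ F, A.indicator (fun n => b.coord n y • b n) n = b.proj (F.filter (· ∈ A)) y := by
    simp [Set.indicator_apply, Finset.sum_filter]
  rw [this]
  exact (b.proj _).le_of_opNorm_le (hK _) y

/-- The vectors and functionals are rescaled so that the former have norm one. The coordinate
projections are precomposed with a bounded projection onto the closed linear span. -/
theorem IsUnconditionalBasicSequence.nonempty_unconditionalSystem {X : Type*}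
    [NormedAddCommGroup X] [NormedSpace ℝ X] [CompleteSpace X] {e : ℕ → X}
    (he : IsUnconditionalBasicSequence e)
    (hc : (Submodule.span ℝ (Set.range e)).topologicalClosure.ClosedComplemented) :
    Nonempty (UnconditionalSystem X) := by
  obtain ⟨b, -⟩ := he
  have hY : IsClosed ((Submodule.span ℝ (Set.range e)).topologicalClosure : Set X) :=
    Submodule.isClosed_topologicalClosure _
  generalize (Submodule.span ℝ (Set.range e)).topologicalClosure = Y at b hc hY
  obtain ⟨p, hp⟩ := hc
  have : CompleteSpace Y := hY.completeSpace_coe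
  obtain ⟨K, hK⟩ := UnconditionalSchauderBasis.exists_norm_tsum_indicator_le b
  have hne : ∀ n, ‖b n‖ ≠ 0 := fun n => norm_ne_zero_iff.2 fun h => by
    simpa [h] using b.ortho n n
  have hsum : ∀ (A : Set ℕ) (y : Y), Summable (A.indicator fun n => b.coord n y • b n) :=
    fun A y => (b.expansion y).summable.indicator A
  let T : Set ℕ → Y →L[ℝ] Y := fun A => LinearMap.mkContinuous
    { toFun := fun y => ∑' n, A.indicator (fun n => b.coord n y • b n) n
      map_add' := fun y z => by
        rw [← (hsum A y).tsum_add (hsum A z)]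
        congr 1
        ext n
        by_cases hn : n ∈ A <;> simp [hn, add_smul]
      map_smul' := fun r y => by
        rw [RingHom.id_apply, ← (hsum A y).tsum_const_smul]
        congr 1
        ext n
        by_cases hn : n ∈ A <;> simp [hn, smul_smul] } K (hK A)
  have hT : ∀ A, ‖T A‖ ≤ max K 0 := fun A => LinearMap.mkContinuous_norm_le' _ _
  refine ⟨{ e := fun n => (‖b n‖⁻¹ • b n : Y)
            c := fun n => ‖b n‖ • (b.coord n ∘L p)
            P := fun A => Y.subtypeL ∘L T A ∘L p
            K := max K 0 * ‖p‖
            ortho := fun m n => ?_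
            norm_e := fun n => ?_
            norm_P := fun A => ?_
            hasSum_P := fun A x => ?_ }⟩
  · have ho : b.coord m (b n) = if m = n then 1 else 0 := by
      simp [b.ortho, Pi.single_apply]
    rw [smul_apply, ContinuousLinearMap.comp_apply, hp, map_smul, ho, smul_eq_mul, smul_eq_mul]
    split_ifs with h
    · subst h
      rw [mul_one, mul_inv_cancel₀ (hne m)]
    · simp
  · have := hne n
    simp only [Submodule.coe_norm] at this ⊢
    simp [norm_smul, this]
  · refine ContinuousLinearMap.opNorm_le_bound _ (by positivity) fun x => ?_
    calc ‖T A (p x)‖ ≤ max K 0 * ‖p x‖ := (T A).le_of_opNorm_le (hT A) _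
      _ ≤ max K 0 * (‖p‖ * ‖x‖) := by gcongr; exact p.le_opNorm x
      _ = _ := by ring
  · have h : (A.indicator fun n => (‖b n‖ • (b.coord n ∘L p)) x • ((‖b n‖⁻¹ • b n : Y) : X)) =
        fun n => Y.subtypeL (A.indicator (fun n => b.coord n (p x) • b n) n) := by
      funext n
      by_cases hn : n ∈ A
      · rw [Set.indicator_of_mem hn, Set.indicator_of_mem hn, smul_apply,
          ContinuousLinearMap.comp_apply, Submodule.subtypeL_apply, Submodule.coe_smul,
          Submodule.coe_smul, smul_smul, smul_eq_mul, mul_right_comm, mul_inv_cancel₀ (hne n),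
          one_mul]
      · simp [hn]
    rw [h]
    exact (hsum A (p x)).hasSum.mapL Y.subtypeL

/-! ### Sets generating a ball with a Daugavet point -/

section

variable {X : Type*} [NormedAddCommGroup X] [NormedSpace ℝ X]

/-- The closed absolutely convex hull of `D` is the unit ball of an equivalent norm on the subspace
`M` for which `x` is a Daugavet point, everything being expressed through functionals: `abs_le` says
that `x` lies in this hull, `norm_le` that the hull contains a ball of `M`, while `exists_neg` and
`exists_pos` say that every `w` and every `-w`, for `w ∈ D`, has distance `2` from `x`. -/
structure IsDaugavetGenerating (M : Submodule ℝ X) (x : X) (D : Set X) : Prop where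
  mem : x ∈ M
  nonempty : D.Nonempty
  subset : D ⊆ M
  bounded : ∃ R, ∀ w ∈ D, ‖w‖ ≤ R
  abs_le : ∀ (f : StrongDual ℝ X) (s : ℝ), (∀ w ∈ D, |f w| ≤ s) → |f x| ≤ s
  norm_le : ∃ C, ∀ (f : StrongDual ℝ X) (s : ℝ), (∀ w ∈ D, |f w| ≤ s) → ∀ m ∈ M, |f m| ≤ C * s * ‖m‖
  exists_neg : ∀ w ∈ D, ∃ ψ : StrongDual ℝ X, ψ x = 1 ∧ ψ w = -1 ∧ ∀ v ∈ D, |ψ v| ≤ 1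
  exists_pos : ∀ w ∈ D, ∃ ψ : StrongDual ℝ X, ψ x = 1 ∧ ψ w = 1 ∧ ∀ v ∈ D, |ψ v| ≤ 1

/-- The points `w ∈ M` of norm at most `R` on the hyperplane `p = 1` at which the functionals `φ j`
take values in `[0, 2]`, the value `2` being attained. -/
def generatingSet (M : Submodule ℝ X) (p : StrongDual ℝ X) (φ : ℕ → StrongDual ℝ X) (R : ℝ) :
    Set X :=
  {w | w ∈ M ∧ ‖w‖ ≤ R ∧ p w = 1 ∧ (∀ j, 0 ≤ φ j w ∧ φ j w ≤ 2) ∧ ∃ j, φ j w = 2}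

/-- If enough vectors `x + u` are weakly approximable by points of `generatingSet M p φ R`, then
this set is generating. The functionals `p - φ j` witness that its points have distance `2`
from `x`, and `p` does so for their negatives. -/
theorem isDaugavetGenerating_generatingSet {M : Submodule ℝ X} {x : X} {p : StrongDual ℝ X}
    {φ : ℕ → StrongDual ℝ X} {R C : ℝ} (hx : x ∈ M) (hpx : p x = 1) (hφx : ∀ j, φ j x = 0)
    (hC : 0 ≤ C) {U : Set X}
    (hU : ∀ u ∈ U, ∀ (f : StrongDual ℝ X) (ε : ℝ), 0 < ε →
      ∃ w ∈ generatingSet M p φ R, |f w - f (x + u)| ≤ ε)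
    (hMU : ∀ u ∈ M, p u = 0 → ‖u‖ ≤ 1 → ∃ u₁ ∈ U, ∃ u₂ ∈ U, u = C • (u₁ - u₂))
    (hU0 : (0 : X) ∈ U) :
    IsDaugavetGenerating M x (generatingSet M p φ R) := by
  have key : ∀ u ∈ U, ∀ (f : StrongDual ℝ X) (s : ℝ),
      (∀ w ∈ generatingSet M p φ R, |f w| ≤ s) → |f (x + u)| ≤ s := by
    intro u hu f s hs
    refine le_of_forall_pos_le_add fun ε hε => ?_
    obtain ⟨w, hw, hwε⟩ := hU u hu f ε hε
    have h1 := hs w hw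
    rw [abs_le] at *
    constructor <;> linarith
  have habs : ∀ (f : StrongDual ℝ X) (s : ℝ),
      (∀ w ∈ generatingSet M p φ R, |f w| ≤ s) → |f x| ≤ s := by
    intro f s hs
    simpa using key 0 hU0 f s hs
  obtain ⟨w₀, hw₀, -⟩ := hU 0 hU0 0 1 one_pos
  refine ⟨hx, ⟨w₀, hw₀⟩, fun w hw => hw.1, ⟨R, fun w hw => hw.2.1⟩, habs,
    ⟨‖p‖ + 4 * C * (1 + ‖p‖ * ‖x‖), fun f s hs m hm => ?_⟩, fun w hw => ?_, fun w hw => ?_⟩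
  · have hs0 : 0 ≤ s := (abs_nonneg _).trans (hs w₀ hw₀)
    have hfx := habs f s hs
    -- the bound on the part of `M` on which `p` vanishes
    have hker : ∀ u ∈ M, p u = 0 → |f u| ≤ 4 * C * s * ‖u‖ := by
      intro u hu hpu
      rcases eq_or_ne u 0 with rfl | hne
      · simp
      have hn : 0 < ‖u‖ := norm_pos_iff.2 hne
      obtain ⟨u₁, h₁, u₂, h₂, h⟩ := hMU (‖u‖⁻¹ • u) (M.smul_mem _ hu) (by simp [hpu])
        (by simp [norm_smul, hn.ne'])
      have hu' : u = (‖u‖ * C) • (u₁ - u₂) := by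
        rw [mul_smul, ← h, smul_smul, mul_inv_cancel₀ hn.ne', one_smul]
      have e₁ := key u₁ h₁ f s hs
      have e₂ := key u₂ h₂ f s hs
      have e : |f u₁ - f u₂| ≤ 2 * s := by
        rw [map_add] at e₁ e₂
        rw [abs_le] at *
        constructor <;> linarith
      have : |f u| = ‖u‖ * C * |f u₁ - f u₂| := by
        conv_lhs => rw [hu']
        rw [map_smul, map_sub, smul_eq_mul, abs_mul, abs_of_nonneg (by positivity)]
      rw [this]
      have := mul_le_mul_of_nonneg_left e (show 0 ≤ ‖u‖ * C by positivity)
      nlinarith [mul_nonneg (mul_nonneg hC hs0) hn.le]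
    have h1 := hker (m - p m • x) (M.sub_mem hm (M.smul_mem _ hx)) (by simp [hpx])
    have hpm : |p m| ≤ ‖p‖ * ‖m‖ := p.le_opNorm m
    have h2 : ‖m - p m • x‖ ≤ (1 + ‖p‖ * ‖x‖) * ‖m‖ := by
      refine (norm_sub_le _ _).trans ?_
      rw [norm_smul, Real.norm_eq_abs]
      nlinarith [mul_le_mul_of_nonneg_right hpm (norm_nonneg x)]
    have h3 : |f m| ≤ |p m| * s + |f (m - p m • x)| := by
      have : f m = p m * f x + f (m - p m • x) := by simp
      rw [this]
      refine (abs_add_le _ _).trans ?_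
      rw [abs_mul]
      gcongr
    calc |f m| ≤ |p m| * s + 4 * C * s * ‖m - p m • x‖ := by linarith
      _ ≤ ‖p‖ * ‖m‖ * s + 4 * C * s * ((1 + ‖p‖ * ‖x‖) * ‖m‖) := by gcongr
      _ = _ := by ring
  · obtain ⟨-, -, hpw, -, j, hj⟩ := hw
    refine ⟨p - φ j, by simp [hpx, hφx], ?_, fun v hv => ?_⟩
    · simp only [sub_apply, hpw, hj]; norm_num
    · obtain ⟨-, -, hpv, hv, -⟩ := hv
      have := hv j
      rw [sub_apply, hpv, abs_le]
      constructor <;> linarith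
  · exact ⟨p, hpx, hw.2.2.1, fun v hv => by simp [hv.2.2.1]⟩

end

namespace UnconditionalSystem

variable {X : Type*} [NormedAddCommGroup X] [NormedSpace ℝ X] (S : UnconditionalSystem X)

theorem tendsto_P_Ioi (x : X) : Tendsto (fun N => S.P (Set.Ioi N) x) atTop (𝓝 0) := by
  have h : ∀ N, S.P (Set.Ioi N) x =
      S.P Set.univ x - ∑ n ∈ Finset.range (N + 1), S.c n x • S.e n := by
    intro N
    have hfin : HasSum ((Finset.range (N + 1) : Set ℕ).indicator fun n => S.c n x • S.e n)
        (∑ n ∈ Finset.range (N + 1), S.c n x • S.e n) := by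
      rw [← Finset.sum_indicator_subset _ (subset_refl _)]
      exact hasSum_sum_of_ne_finset_zero fun n hn => by simp_all
    refine (S.hasSum_P _ x).unique ?_
    convert (S.hasSum_P Set.univ x).sub hfin using 1
    funext n
    by_cases hn : N < n
    · simp [hn]
    · simp [hn, Nat.lt_succ_of_le (not_lt.1 hn)]
  have ht := (S.hasSum_P Set.univ x).tendsto_sum_nat.comp (tendsto_add_atTop_nat 1)
  have := (tendsto_const_nhds (x := S.P Set.univ x)).sub ht
  rw [sub_self] at this
  refine this.congr fun N => ?_
  simp [h]

/-- Splitting a vector into small multiples of its parts with coordinates of prescribed signs. -/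
theorem exists_eq_smul_sub (a : ℕ → ℝ) {r : ℝ} (hr : 0 < r) :
    ∃ C : ℝ, 0 ≤ C ∧ ∀ u : X, ‖u‖ ≤ 1 → ∃ (A : Set ℕ) (κ : ℝ),
      (‖κ • (u - S.P A u)‖ ≤ r ∧ ∀ n, 0 ≤ S.c n (κ • (u - S.P A u)) * a n) ∧
      (‖κ • (-S.P A u)‖ ≤ r ∧ ∀ n, 0 ≤ S.c n (κ • (-S.P A u)) * a n) ∧
      u = C • (κ • (u - S.P A u) - κ • (-S.P A u)) := by
  have hK := S.K_nonneg
  refine ⟨r⁻¹ * (1 + S.K), by positivity, fun u hu => ⟨{n | S.c n u * a n < 0}, r / (1 + S.K), ?_⟩⟩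
  set A : Set ℕ := {n | S.c n u * a n < 0}
  have hκ : 0 < r / (1 + S.K) := by positivity
  have hPu : ‖S.P A u‖ ≤ S.K := (S.norm_P_apply_le A u).trans (by nlinarith)
  have hPu' : ‖u - S.P A u‖ ≤ 1 + S.K := (norm_sub_le _ _).trans (add_le_add hu hPu)
  have hnorm : ∀ v : X, ‖v‖ ≤ 1 + S.K → ‖(r / (1 + S.K)) • v‖ ≤ r := fun v hv => by
    rw [norm_smul, Real.norm_of_nonneg hκ.le]
    calc _ ≤ r / (1 + S.K) * (1 + S.K) := by gcongr
      _ = r := by field_simp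
  refine ⟨⟨hnorm _ hPu', fun n => ?_⟩, ⟨hnorm _ (by rw [norm_neg]; linarith), fun n => ?_⟩, ?_⟩
  · rw [map_smul, smul_eq_mul, mul_assoc]
    refine mul_nonneg hκ.le ?_
    by_cases hn : n ∈ A
    · simp [S.c_P, hn]
    · simpa [S.c_P, hn] using not_lt.1 hn
  · rw [map_smul, smul_eq_mul, mul_assoc]
    refine mul_nonneg hκ.le ?_
    by_cases hn : n ∈ A
    · simpa [S.c_P, hn] using le_of_lt hn
    · simp [S.c_P, hn]
  · rw [← smul_sub, smul_smul]
    have : r⁻¹ * (1 + S.K) * (r / (1 + S.K)) = 1 := by field_simp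
    simp [this]

/-- The case in which no functional is bounded away from zero on the sequence: perturb by multiples
of single basis vectors, and test with the coordinate functionals. -/
theorem exists_isDaugavetGenerating_of_small {M : Submodule ℝ X} (heM : ∀ n, S.e n ∈ M)
    (hPM : ∀ A, ∀ u ∈ M, S.P A u ∈ M)
    (h : ∀ (f : StrongDual ℝ X) (ε : ℝ), 0 < ε → ∃ n, |f (S.e (n + 1))| ≤ ε) :
    ∃ D, IsDaugavetGenerating M (S.e 0) D := by
  have hK := S.K_nonneg
  obtain ⟨C, hC, hsplit⟩ := S.exists_eq_smul_sub (fun _ => 1) (r := (1 + S.K)⁻¹) (by positivity)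
  have hr1 : (1 + S.K)⁻¹ ≤ 1 := inv_le_one_of_one_le₀ (by linarith)
  let U : Set X := {u | u ∈ M ∧ S.c 0 u = 0 ∧ ‖u‖ ≤ (1 + S.K)⁻¹ ∧ ∀ n, 0 ≤ S.c n u * 1}
  refine ⟨_, isDaugavetGenerating_generatingSet (R := 4) (C := C) (U := U)
    (φ := fun n => S.c (n + 1)) (p := S.c 0) (heM 0) (S.ortho_self 0)
    (fun j => S.ortho_ne (by simp)) hC ?_ ?_ ⟨M.zero_mem, by simp; positivity⟩⟩
  · rintro u ⟨huM, hu0, hu1, hu⟩ f ε hε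
    have hu : ∀ n, 0 ≤ S.c (n + 1) u ∧ S.c (n + 1) u ≤ 2 := by
      refine fun n => ⟨by simpa using hu (n + 1), ?_⟩
      have h1 := (le_abs_self _).trans (S.norm_c_apply_le (n + 1) u)
      have h2 : S.K * ‖u‖ ≤ (1 + S.K) * (1 + S.K)⁻¹ := by gcongr; linarith
      rw [mul_inv_cancel₀ (by positivity)] at h2
      linarith
    obtain ⟨n, hn⟩ := h f (ε / 2) (by positivity)
    have hr0 : 0 ≤ 2 - S.c (n + 1) u := by linarith [(hu n).2]
    have hr2 : 2 - S.c (n + 1) u ≤ 2 := by linarith [(hu n).1]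
    refine ⟨S.e 0 + u + (2 - S.c (n + 1) u) • S.e (n + 1),
      ⟨M.add_mem (M.add_mem (heM 0) huM) (M.smul_mem _ (heM _)), ?_, ?_, fun j => ?_, n, ?_⟩, ?_⟩
    · refine (norm_add₃_le).trans ?_
      rw [norm_smul, S.norm_e, S.norm_e, Real.norm_eq_abs, abs_of_nonneg hr0]
      linarith
    · simp [S.ortho, hu0]
    · rcases eq_or_ne j n with rfl | hj
      · simp [S.ortho]
      · simpa [S.ortho, hj] using hu j
    · simp [S.ortho]
    · rw [map_add, add_sub_cancel_left, map_smul, smul_eq_mul, abs_mul, abs_of_nonneg hr0]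
      calc _ ≤ 2 * (ε / 2) := by gcongr
        _ = ε := by ring
  · intro u hu hu0 hu1
    obtain ⟨A, κ, ⟨h1, h1'⟩, ⟨h2, h2'⟩, h3⟩ := hsplit u hu1
    refine ⟨_, ⟨M.smul_mem _ (M.sub_mem hu (hPM A u hu)), ?_, h1, h1'⟩,
      _, ⟨M.smul_mem _ (M.neg_mem (hPM A u hu)), ?_, h2, h2'⟩, h3⟩
    all_goals by_cases h0 : 0 ∈ A <;> simp [S.c_P, hu0]

/-- The case in which some functional `f₀` is bounded away from zero on the sequence, which then
spans a copy of `ℓ¹`. After rescaling, `f₀` is the summation functional and its tails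
`f₀ ∘ P (j, ∞)` serve as test functionals. They take only the values `0` and `1` on differences
`e t - e s` with `s < t`, and any given functional is almost equal at two such basis vectors. -/
theorem exists_isDaugavetGenerating_of_large {M : Submodule ℝ X} (heM : ∀ n, S.e n ∈ M)
    (hPM : ∀ A, ∀ u ∈ M, S.P A u ∈ M) {f₀ : StrongDual ℝ X} {δ : ℝ} (hδ : 0 < δ)
    (h : ∀ n, δ ≤ |f₀ (S.e (n + 1))|) :
    ∃ D, IsDaugavetGenerating M (S.e 0) D := by
  have hK := S.K_nonneg
  have hane : ∀ n, 0 < n → f₀ (S.e n) ≠ 0 := by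
    intro n hn h0
    obtain ⟨m, rfl⟩ := Nat.exists_eq_succ_of_ne_zero hn.ne'
    have := h m
    rw [Nat.succ_eq_add_one] at h0
    rw [h0, abs_zero] at this
    linarith
  have hainv : ∀ n, 0 < n → ‖(f₀ (S.e n))⁻¹ • S.e n‖ ≤ δ⁻¹ := by
    intro n hn
    obtain ⟨m, rfl⟩ := Nat.exists_eq_succ_of_ne_zero hn.ne'
    rw [norm_smul, S.norm_e, mul_one, norm_inv, Real.norm_eq_abs]
    exact inv_anti₀ hδ (h m)
  set r : ℝ := (1 + ‖f₀‖ * S.K)⁻¹ with hr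
  have hr0 : 0 < r := by positivity
  have hr1 : r ≤ 1 := inv_le_one_of_one_le₀ (by nlinarith [norm_nonneg f₀])
  obtain ⟨C, hC, hsplit⟩ := S.exists_eq_smul_sub (fun n => f₀ (S.e n)) hr0
  let U : Set X := {u | u ∈ M ∧ S.c 0 u = 0 ∧ ‖u‖ ≤ r ∧ ∀ n, 0 ≤ S.c n u * f₀ (S.e n)}
  refine ⟨_, isDaugavetGenerating_generatingSet (R := 2 + S.K + 4 * δ⁻¹) (C := C) (U := U)
    (φ := fun j => f₀ ∘L S.P (Set.Ioi j)) (p := S.c 0) (heM 0) (S.ortho_self 0)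
    (fun j => by simp [S.P_e_of_notMem]) hC ?_ ?_ ⟨M.zero_mem, by simp [hr0.le]⟩⟩
  · rintro u ⟨huM, hu0, hu1, hu⟩ f ε hε
    have hf₀ : ∀ B, 0 ≤ f₀ (S.P B u) ∧ f₀ (S.P B u) ≤ 2 := by
      refine fun B => ⟨(S.hasSum_apply_P f₀ B u).nonneg fun n => ?_, ?_⟩
      · exact Set.indicator_nonneg (fun n _ => hu n) n
      · have h1 : f₀ (S.P B u) ≤ ‖f₀‖ * (S.K * r) := (le_abs_self _).trans <|
          (f₀.le_opNorm _).trans (by gcongr; exact (S.norm_P_apply_le B u).trans (by gcongr))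
        have h2 : (1 + ‖f₀‖ * S.K) * r = 1 := mul_inv_cancel₀ (by positivity)
        nlinarith
    -- cut off the tail of `u`
    obtain ⟨N, hN⟩ : ∃ N, |f (S.P (Set.Ioi N) u)| ≤ ε / 2 := by
      have ht : Tendsto (fun N => |f (S.P (Set.Ioi N) u)|) atTop (𝓝 0) := by
        simpa using ((f.continuous.tendsto 0).comp (S.tendsto_P_Ioi u)).abs
      exact (ht.eventually_le_const (by positivity : 0 < ε / 2)).exists
    -- two basis vectors beyond the cut which `f` does not distinguish
    obtain ⟨s, t, hNs, hst, hfst⟩ : ∃ s t, N < s ∧ s < t ∧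
        |f ((f₀ (S.e t))⁻¹ • S.e t) - f ((f₀ (S.e s))⁻¹ • S.e s)| ≤ ε / 4 := by
      have hb : ∀ n, f ((f₀ (S.e (n + 1)))⁻¹ • S.e (n + 1)) ∈
          Metric.closedBall (0 : ℝ) (‖f‖ * δ⁻¹) := fun n => by
        rw [mem_closedBall_zero_iff]
        exact (f.le_opNorm _).trans (by gcongr; exact hainv _ n.succ_pos)
      obtain ⟨z, -, θ, hθ, hlim⟩ := tendsto_subseq_of_bounded Metric.isBounded_closedBall hb
      obtain ⟨k, hk⟩ := Metric.cauchySeq_iff'.1 hlim.cauchySeq (ε / 8) (by positivity)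
      have h1 := hk (max k N) (le_max_left _ _)
      have h2 := hk (max k N + 1) ((le_max_left _ _).trans (Nat.le_succ _))
      refine ⟨θ (max k N) + 1, θ (max k N + 1) + 1, ?_, ?_, ?_⟩
      · exact Nat.lt_succ_of_le ((le_max_right _ _).trans hθ.le_apply)
      · exact Nat.succ_lt_succ (hθ (Nat.lt_succ_self _))
      · have := (dist_triangle_right _ _ _).trans (add_le_add h2.le h1.le)
        rw [Real.dist_eq] at this
        simp only [Function.comp_apply] at this
        linarith
    have hs0 : 0 < s := by omega
    have ht0 : 0 < t := by omega
    have hcut : ∀ j, S.P (Set.Ioi j) (u - S.P (Set.Ioi N) u) = S.P (Set.Ioc j N) u := by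
      refine fun j => S.P_eq_of_indicator_eq fun n => ?_
      by_cases hj : j < n <;> by_cases hn : N < n <;> simp [hj, hn, S.c_P, not_lt.1]
    have hval : ∀ j n, 0 < n →
        f₀ (S.P (Set.Ioi j) ((f₀ (S.e n))⁻¹ • S.e n)) = if j < n then 1 else 0 := by
      intro j n hn
      split_ifs with hj
      · rw [map_smul, S.P_e_of_mem (by exact hj), map_smul, smul_eq_mul,
          inv_mul_cancel₀ (hane n hn)]
      · rw [map_smul, S.P_e_of_notMem (by exact hj)]
        simp
    have hφ : ∀ j, (f₀ ∘L S.P (Set.Ioi j)) (S.e 0 + (u - S.P (Set.Ioi N) u) +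
        (2 : ℝ) • ((f₀ (S.e t))⁻¹ • S.e t - (f₀ (S.e s))⁻¹ • S.e s)) =
        f₀ (S.P (Set.Ioc j N) u) + 2 * ((if j < t then 1 else 0) - if j < s then 1 else 0) := by
      intro j
      rw [ContinuousLinearMap.comp_apply, map_add, map_add, map_add, map_add, hcut,
        map_smul, map_smul, map_sub, map_sub, hval j t ht0, hval j s hs0, S.P_e_of_notMem (by simp)]
      simp
    have hempty : ∀ j, N ≤ j → f₀ (S.P (Set.Ioc j N) u) = 0 := by
      intro j hj
      have := S.hasSum_P ∅ u
      rw [Set.indicator_empty] at this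
      rw [Set.Ioc_eq_empty (by omega), this.unique hasSum_zero, map_zero]
    refine ⟨S.e 0 + (u - S.P (Set.Ioi N) u) +
      (2 : ℝ) • ((f₀ (S.e t))⁻¹ • S.e t - (f₀ (S.e s))⁻¹ • S.e s),
      ⟨M.add_mem (M.add_mem (heM 0) (M.sub_mem huM (hPM _ _ huM))) (M.smul_mem _
        (M.sub_mem (M.smul_mem _ (heM _)) (M.smul_mem _ (heM _)))), ?_, ?_, fun j => ?_, s, ?_⟩, ?_⟩
    · have h1 : ‖u - S.P (Set.Ioi N) u‖ ≤ 1 + S.K := by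
        refine (norm_sub_le _ _).trans (add_le_add (hu1.trans hr1) ?_)
        exact (S.norm_P_apply_le _ u).trans (by nlinarith)
      have h2 : ‖(2 : ℝ) • ((f₀ (S.e t))⁻¹ • S.e t - (f₀ (S.e s))⁻¹ • S.e s)‖ ≤ 4 * δ⁻¹ := by
        rw [norm_smul, Real.norm_two]
        linarith [norm_sub_le ((f₀ (S.e t))⁻¹ • S.e t) ((f₀ (S.e s))⁻¹ • S.e s), hainv t ht0,
          hainv s hs0]
      refine norm_add₃_le.trans ?_
      rw [S.norm_e]
      linarith
    · simp [S.ortho, S.c_P, hu0, hs0.ne, ht0.ne]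
    · rw [hφ]
      rcases lt_or_ge j N with hj | hj
      · rw [if_pos (by omega), if_pos (by omega)]
        simpa using hf₀ (Set.Ioc j N)
      · rw [hempty j hj]
        split_ifs <;> first | omega | norm_num
    · rw [hφ, hempty s hNs.le, if_pos hst, if_neg (lt_irrefl s)]
      norm_num
    · simp only [map_add, map_smul, map_sub, smul_eq_mul] at hfst ⊢
      rw [abs_le] at *
      constructor <;> linarith
  · intro u hu hu0 hu1
    obtain ⟨A, κ, ⟨h1, h1'⟩, ⟨h2, h2'⟩, h3⟩ := hsplit u hu1
    refine ⟨_, ⟨M.smul_mem _ (M.sub_mem hu (hPM A u hu)), ?_, h1, h1'⟩,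
      _, ⟨M.smul_mem _ (M.neg_mem (hPM A u hu)), ?_, h2, h2'⟩, h3⟩
    all_goals by_cases h0 : 0 ∈ A <;> simp [S.c_P, hu0]

theorem exists_isDaugavetGenerating {M : Submodule ℝ X} (heM : ∀ n, S.e n ∈ M)
    (hPM : ∀ A, ∀ u ∈ M, S.P A u ∈ M) : ∃ D, IsDaugavetGenerating M (S.e 0) D := by
  by_cases h : ∀ (f : StrongDual ℝ X) (ε : ℝ), 0 < ε → ∃ n, |f (S.e (n + 1))| ≤ ε
  · exact S.exists_isDaugavetGenerating_of_small heM hPM h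
  · push Not at h
    obtain ⟨f₀, δ, hδ, h⟩ := h
    exact S.exists_isDaugavetGenerating_of_large heM hPM hδ fun n => (h n).le

end UnconditionalSystem

/-! ### Sets of functionals generating a dual ball with a weak* Daugavet point -/

/-- The supremum of `|g y|` over `g ∈ G` is an equivalent norm whose dual ball, the weak* closed
absolutely convex hull of `G`, contains `p` and has all points of `G` and `-G` at distance `2` from
`p`, as witnessed by vectors in `M`. -/
structure IsWeakStarDaugavetGenerating {X : Type*} [NormedAddCommGroup X] [NormedSpace ℝ X]
    (M : Submodule ℝ X) (p : StrongDual ℝ X) (G : Set (StrongDual ℝ X)) : Prop where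
  nonempty : G.Nonempty
  bounded : ∃ R, ∀ g ∈ G, ‖g‖ ≤ R
  abs_le : ∀ (y : X) (s : ℝ), (∀ g ∈ G, |g y| ≤ s) → |p y| ≤ s
  norm_le : ∃ C, ∀ (y : X) (s : ℝ), (∀ g ∈ G, |g y| ≤ s) → ‖y‖ ≤ C * s
  exists_neg : ∀ g ∈ G, ∃ z ∈ M, p z = 1 ∧ g z = -1 ∧ ∀ g' ∈ G, |g' z| ≤ 1
  exists_pos : ∀ g ∈ G, ∃ z ∈ M, p z = 1 ∧ g z = 1 ∧ ∀ g' ∈ G, |g' z| ≤ 1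

namespace UnconditionalSystem

variable {X : Type*} [NormedAddCommGroup X] [NormedSpace ℝ X] (S : UnconditionalSystem X)

/-- The dual counterpart of `exists_isDaugavetGenerating_of_small`. Since the coordinate functionals
are always weak* null, no case distinction is needed. -/
theorem exists_isWeakStarDaugavetGenerating {M : Submodule ℝ X} (heM : ∀ n, S.e n ∈ M) :
    ∃ G, IsWeakStarDaugavetGenerating M (S.c 0) G := by
  have hK := S.K_nonneg
  let G : Set (StrongDual ℝ X) := {g | ‖g‖ ≤ 1 + 3 * S.K ∧ g (S.e 0) = 1 ∧
    (∀ n, 0 ≤ g (S.e (n + 1)) ∧ g (S.e (n + 1)) ≤ 2) ∧ ∃ n, g (S.e (n + 1)) = 2}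
  -- small functionals with nonnegative coordinates, translated by `c 0`, are weak* limits of `G`
  have key : ∀ h : StrongDual ℝ X, ‖h‖ ≤ 1 → h (S.e 0) = 0 → (∀ n, 0 ≤ h (S.e n)) →
      ∀ (y : X) (s : ℝ), (∀ g ∈ G, |g y| ≤ s) → |S.c 0 y + h y| ≤ s := by
    intro h hh h0 hpos y s hs
    refine le_of_forall_pos_le_add fun ε hε => ?_
    have hlim : Tendsto (fun n => |S.c (n + 1) y|) atTop (𝓝 0) := by
      simpa using ((S.tendsto_c y).comp (tendsto_add_atTop_nat 1)).abs
    obtain ⟨n, hn⟩ := (hlim.eventually_le_const (by positivity : 0 < ε / 2)).exists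
    have hle : ∀ n, h (S.e n) ≤ 1 := fun n => (le_abs_self _).trans <|
      (h.le_opNorm _).trans (by rw [S.norm_e]; linarith)
    have hr0 : 0 ≤ 2 - h (S.e (n + 1)) := by linarith [hle (n + 1)]
    have hr2 : 2 - h (S.e (n + 1)) ≤ 2 := by linarith [hpos (n + 1)]
    have hg := hs (S.c 0 + h + (2 - h (S.e (n + 1))) • S.c (n + 1))
      ⟨?_, ?_, fun j => ?_, n, ?_⟩
    · have h1 : |(2 - h (S.e (n + 1))) * S.c (n + 1) y| ≤ ε := by
        rw [abs_mul, abs_of_nonneg hr0]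
        calc _ ≤ 2 * (ε / 2) := by gcongr
          _ = ε := by ring
      rw [add_apply, add_apply, smul_apply, smul_eq_mul] at hg
      rw [abs_le] at *
      constructor <;> linarith
    · refine norm_add₃_le.trans ?_
      rw [norm_smul, Real.norm_of_nonneg hr0]
      have := mul_le_mul hr2 (S.norm_c_le (n + 1)) (norm_nonneg _) zero_le_two
      linarith [S.norm_c_le 0]
    · simp [S.ortho, h0]
    · rcases eq_or_ne j n with rfl | hj
      · simp [S.ortho]
      · simpa [S.ortho, hj.symm] using ⟨hpos (j + 1), by linarith [hle (j + 1)]⟩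
    · simp [S.ortho]
  have habs : ∀ (y : X) (s : ℝ), (∀ g ∈ G, |g y| ≤ s) → |S.c 0 y| ≤ s := by
    intro y s hs
    simpa using key 0 (by simp) (by simp) (by simp) y s hs
  set L : ℝ := (1 + S.K) * (1 + S.K) with hL
  have hL0 : 0 < L := by positivity
  refine ⟨G, ⟨S.c 0 + (2 : ℝ) • S.c 1, ?_, ?_, fun j => ?_, 0, ?_⟩, ⟨_, fun g hg => hg.1⟩, habs,
    ⟨1 + 4 * L, fun y s hs => ?_⟩, ?_, ?_⟩
  · refine (norm_add_le _ _).trans ?_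
    rw [norm_smul, Real.norm_two]
    linarith [S.norm_c_le 0, S.norm_c_le 1]
  · simp [S.ortho]
  · rcases eq_or_ne j 0 with rfl | hj
    · simp [S.ortho]
    · simp [S.ortho, hj]
  · simp [S.ortho]
  · obtain ⟨h, hh, hy⟩ := exists_dual_vector'' ℝ y
    -- split off the coordinate `0` of a norming functional, and then its negative part
    set k : StrongDual ℝ X := h - h (S.e 0) • S.c 0 with hk
    have hh0 : |h (S.e 0)| ≤ 1 := (h.le_opNorm _).trans (by rw [S.norm_e]; linarith)
    have hk0 : k (S.e 0) = 0 := by simp [hk, S.ortho]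
    have hkn : ‖k‖ ≤ 1 + S.K := by
      refine (norm_sub_le _ _).trans (add_le_add hh ?_)
      rw [norm_smul, Real.norm_eq_abs]
      nlinarith [S.norm_c_le 0, norm_nonneg (S.c 0)]
    set A : Set ℕ := {n | k (S.e n) < 0}
    have hsmall : ∀ T : X →L[ℝ] X, ‖T‖ ≤ 1 + S.K → ‖L⁻¹ • (k ∘L T)‖ ≤ 1 := by
      intro T hT
      rw [norm_smul, Real.norm_of_nonneg (by positivity), inv_mul_le_iff₀ hL0, mul_one]
      exact (k.opNorm_comp_le T).trans (by rw [hL]; gcongr)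
    have h1 := key (L⁻¹ • (k ∘L (ContinuousLinearMap.id ℝ X - S.P A)))
      (hsmall _ ((norm_sub_le _ _).trans
        (add_le_add ContinuousLinearMap.norm_id_le (S.norm_P A)))) ?_ ?_ y s hs
    · have h2 := key (L⁻¹ • (k ∘L (-S.P A)))
        (hsmall _ (by rw [norm_neg]; linarith [S.norm_P A])) ?_ ?_ y s hs
      · have h3 := habs y s hs
        have e1 : |L⁻¹ * k y| ≤ 4 * s := by
          have : L⁻¹ * k y = (S.c 0 y + (L⁻¹ • (k ∘L (ContinuousLinearMap.id ℝ X - S.P A))) y) -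
              (S.c 0 y + (L⁻¹ • (k ∘L (-S.P A))) y) := by
            simp; ring
          rw [this]
          refine (abs_sub _ _).trans ?_
          have : 0 ≤ s := (abs_nonneg _).trans h1
          linarith
        rw [abs_mul, abs_of_pos (inv_pos.2 hL0), inv_mul_le_iff₀ hL0] at e1
        have e2 : ‖y‖ = h (S.e 0) * S.c 0 y + k y := by
          rw [hk]
          simpa using hy.symm
        have e3 : h (S.e 0) * S.c 0 y ≤ s := by
          refine (le_abs_self _).trans ?_
          rw [abs_mul]
          nlinarith [abs_nonneg (S.c 0 y), abs_nonneg (h (S.e 0))]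
        linarith [le_abs_self (k y)]
      · by_cases hn : 0 ∈ A
        · simp [S.P_e_of_mem hn, hk0]
        · simp [S.P_e_of_notMem hn]
      · intro n
        by_cases hn : n ∈ A
        · have : k (S.e n) ≤ 0 := le_of_lt hn
          have := mul_nonneg (inv_pos.2 hL0).le (neg_nonneg.2 this)
          simpa [S.P_e_of_mem hn] using this
        · simp [S.P_e_of_notMem hn]
    · by_cases hn : 0 ∈ A
      · simp [S.P_e_of_mem hn]
      · simp [S.P_e_of_notMem hn, hk0]
    · intro n
      by_cases hn : n ∈ A
      · simp [S.P_e_of_mem hn]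
      · have := mul_nonneg (inv_pos.2 hL0).le (not_lt.1 hn)
        simpa [S.P_e_of_notMem hn] using this
  · rintro g ⟨-, hg0, -, n, hn⟩
    refine ⟨S.e 0 - S.e (n + 1), M.sub_mem (heM _) (heM _), by simp [S.ortho], ?_, ?_⟩
    · rw [map_sub, hg0, hn]; norm_num
    · rintro g' ⟨-, hg0', hg', -⟩
      have := hg' n
      rw [map_sub, hg0', abs_le]
      constructor <;> linarith
  · rintro g hg
    exact ⟨S.e 0, heM 0, S.ortho_self 0, hg.2.1, fun g' hg' => by simp [hg'.2.1]⟩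

end UnconditionalSystem

/-! ### Transfer to an equivalent norm -/

namespace EquivNorm

variable {X : Type*} [NormedAddCommGroup X] [NormedSpace ℝ X] (N : EquivNorm X)

/-- The identity map from `X` to `X` endowed with the equivalent norm, as an isomorphism. -/
noncomputable def toSpace : X ≃L[ℝ] N.Space where
  toLinearEquiv := (LinearEquiv.refl ℝ X : X ≃ₗ[ℝ] X)
  continuous_toFun := by
    obtain ⟨c, C, -, -, h⟩ := N.equiv
    exact AddMonoidHomClass.continuous_of_bound
      (show X →ₗ[ℝ] N.Space from (LinearMap.id : X →ₗ[ℝ] X)) C fun x => (h x).2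
  continuous_invFun := by
    obtain ⟨c, C, hc, -, h⟩ := N.equiv
    refine AddMonoidHomClass.continuous_of_bound
      (show N.Space →ₗ[ℝ] X from (LinearMap.id : X →ₗ[ℝ] X)) c⁻¹ fun x => ?_
    rw [← div_eq_inv_mul, le_div_iff₀ hc, mul_comm]
    exact (h x).1

theorem norm_toSpace (x : X) : ‖N.toSpace x‖ = N.toSeminorm x := rfl

/-- The functional on `X` with the equivalent norm given by a functional on `X`. -/
noncomputable def toDual (g : StrongDual ℝ X) : StrongDual ℝ N.Space := g ∘L (N.toSpace.symm : N.Space →L[ℝ] X)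

theorem toDual_toSpace (g : StrongDual ℝ X) (x : X) : N.toDual g (N.toSpace x) = g x := by
  simp [toDual]

theorem norm_toDual_le {g : StrongDual ℝ X} {s : ℝ} (hs : 0 ≤ s)
    (h : ∀ x, |g x| ≤ s * N.toSeminorm x) : ‖N.toDual g‖ ≤ s := by
  refine ContinuousLinearMap.opNorm_le_bound _ hs fun x => ?_
  obtain ⟨x, rfl⟩ := N.toSpace.surjective x
  rw [toDual_toSpace, norm_toSpace]
  exact h x

theorem le_norm_toDual {g : StrongDual ℝ X} {z : X} (hz : N.toSeminorm z ≤ 1) :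
    |g z| ≤ ‖N.toDual g‖ := by
  rw [← N.toDual_toSpace g z]
  exact (N.toDual g).unit_le_opNorm _ hz

theorem exists_toDual_eq (f : StrongDual ℝ N.Space) : ∃ g, N.toDual g = f :=
  ⟨f ∘L (N.toSpace : X →L[ℝ] N.Space), by ext; simp [toDual]⟩

theorem isDaugavetPoint_toSpace {x : X} (hx : N.toSeminorm x = 1)
    (h : ∀ f : StrongDual ℝ X, (∀ y, |f y| ≤ N.toSeminorm y) →
      ∀ β : ℝ, 0 < β → β < 1 → (∃ y, β * N.toSeminorm y < |f y|) →
        ∃ y, N.toSeminorm y ≤ 1 ∧ β < f y ∧ 1 + β ≤ N.toSeminorm (x - y)) :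
    IsDaugavetPoint (N.toSpace x) := by
  refine ⟨hx, fun f hf α hα => ⟨?_, fun b hb => ?_⟩⟩
  · rintro _ ⟨y, ⟨hy, -⟩, rfl⟩
    refine (norm_sub_le _ _).trans ?_
    rw [norm_toSpace, hx]
    linarith
  · obtain ⟨f, rfl⟩ := N.exists_toDual_eq f
    by_contra! hb2
    set β := max (max (1 - α) (b / 2)) (1 / 2)
    have h1 : 1 - α ≤ β := (le_max_left _ _).trans (le_max_left _ _)
    have h2 : b / 2 ≤ β := (le_max_right _ _).trans (le_max_left _ _)
    have h3 : 1 / 2 ≤ β := le_max_right _ _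
    have h4 : β < 1 := max_lt (max_lt (by linarith) (by linarith)) (by norm_num)
    obtain ⟨y, hy1, hfy, hxy⟩ := h f
      (fun y => by
        have := (N.toDual f).le_opNorm (N.toSpace y)
        rwa [hf, one_mul, norm_toSpace, toDual_toSpace] at this)
      β (by linarith) h4 (by
        by_contra! hle
        have := N.norm_toDual_le (by linarith) hle
        linarith)
    have := hb ⟨N.toSpace y, ⟨hy1, by rw [toDual_toSpace]; linarith⟩, rfl⟩
    dsimp only at this
    rw [← map_sub, norm_toSpace] at this
    linarith

theorem isWeakStarDaugavetPoint_toDual {p : StrongDual ℝ X} (hp : ∀ y, |p y| ≤ N.toSeminorm y)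
    (hp1 : ∃ z, N.toSeminorm z ≤ 1 ∧ p z = 1)
    (h : ∀ x, N.toSeminorm x = 1 → ∀ β < 1, ∃ g : StrongDual ℝ X,
      (∀ y, |g y| ≤ N.toSeminorm y) ∧ β < g x ∧ ∃ z, N.toSeminorm z ≤ 1 ∧ p z - g z = 2) :
    IsWeakStarDaugavetPoint (N.toDual p) := by
  have hle : ‖N.toDual p‖ ≤ 1 := N.norm_toDual_le zero_le_one (by simpa using hp)
  refine ⟨le_antisymm hle ?_, fun x hx α hα => ⟨?_, fun b hb => ?_⟩⟩
  · obtain ⟨z, hz, hpz⟩ := hp1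
    simpa [hpz] using N.le_norm_toDual (g := p) hz
  · rintro _ ⟨g, ⟨hg, -⟩, rfl⟩
    exact (norm_sub_le _ _).trans (by linarith)
  · obtain ⟨x, rfl⟩ := N.toSpace.surjective x
    obtain ⟨g, hg, hgx, z, hz, hpgz⟩ := h x hx (1 - α) (by linarith)
    have h1 := hb ⟨N.toDual g, ⟨N.norm_toDual_le zero_le_one (by simpa using hg),
      by rwa [toDual_toSpace]⟩, rfl⟩
    have h2 := N.le_norm_toDual (g := p - g) hz
    have h3 : N.toDual (p - g) = N.toDual p - N.toDual g := by ext; simp [toDual]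
    rw [sub_apply, hpgz, abs_two, h3] at h2
    exact h2.trans h1

end EquivNorm

/-! ### The renorming -/

section

variable {X : Type*} [NormedAddCommGroup X] [NormedSpace ℝ X]

/-- The seminorm `x ↦ sup {|f x| : f ∈ F}` given by a bounded set `F` of functionals. -/
noncomputable def supSeminorm (F : Set (StrongDual ℝ X)) (hF : ∃ R, ∀ f ∈ F, ∀ x, |f x| ≤ R * ‖x‖) :
    Seminorm ℝ X :=
  Seminorm.ofSMulLE (fun x => sSup ((fun f : StrongDual ℝ X => |f x|) '' F))
    (by
      refine le_antisymm (Real.sSup_le ?_ le_rfl) (Real.sSup_nonneg ?_) <;>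
      · rintro _ ⟨f, -, rfl⟩
        simp)
    (fun x y => by
      obtain ⟨R, hR⟩ := hF
      have hbdd : ∀ z, BddAbove ((fun f : StrongDual ℝ X => |f z|) '' F) := fun z =>
        ⟨R * ‖z‖, by rintro _ ⟨f, hf, rfl⟩; exact hR f hf z⟩
      have hnn : ∀ z, 0 ≤ sSup ((fun f : StrongDual ℝ X => |f z|) '' F) := fun z =>
        Real.sSup_nonneg (by rintro _ ⟨f, -, rfl⟩; exact abs_nonneg _)
      refine Real.sSup_le ?_ (add_nonneg (hnn x) (hnn y))
      rintro _ ⟨f, hf, rfl⟩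
      dsimp only
      rw [map_add]
      exact (abs_add_le _ _).trans (add_le_add (le_csSup (hbdd x) ⟨f, hf, rfl⟩)
        (le_csSup (hbdd y) ⟨f, hf, rfl⟩)))
    (fun r x => by
      obtain ⟨R, hR⟩ := hF
      refine Real.sSup_le ?_ (mul_nonneg (norm_nonneg _)
        (Real.sSup_nonneg (by rintro _ ⟨f, -, rfl⟩; exact abs_nonneg _)))
      rintro _ ⟨f, hf, rfl⟩
      dsimp only
      rw [map_smul, smul_eq_mul, abs_mul, Real.norm_eq_abs]
      gcongr
      exact le_csSup ⟨R * ‖x‖, by rintro _ ⟨f, hf, rfl⟩; exact hR f hf x⟩ ⟨f, hf, rfl⟩)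

variable {F : Set (StrongDual ℝ X)} (hF : ∃ R, ∀ f ∈ F, ∀ x, |f x| ≤ R * ‖x‖)

theorem le_supSeminorm {f : StrongDual ℝ X} (hf : f ∈ F) (x : X) : |f x| ≤ supSeminorm F hF x := by
  refine le_csSup ?_ ⟨f, hf, rfl⟩
  obtain ⟨R, hR⟩ := hF
  exact ⟨R * ‖x‖, by rintro _ ⟨f, hf, rfl⟩; exact hR f hf x⟩

theorem supSeminorm_le {x : X} {s : ℝ} (hs : 0 ≤ s) (h : ∀ f ∈ F, |f x| ≤ s) :
    supSeminorm F hF x ≤ s :=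
  Real.sSup_le (by rintro _ ⟨f, hf, rfl⟩; exact h f hf) hs

theorem exists_lt_of_lt_supSeminorm (hne : F.Nonempty) {x : X} {s : ℝ}
    (h : s < supSeminorm F hF x) : ∃ f ∈ F, s < |f x| := by
  obtain ⟨_, ⟨f, hf, rfl⟩, hs⟩ := exists_lt_of_lt_csSup (hne.image _) h
  exact ⟨f, hf, hs⟩

/-- Given a bounded projection `Q`, put the norm with the polar of `D` as dual ball on `ker Q`, the
norm with `G` as a norming set on `range Q`, and form the `ℓ¹`-sum. Daugavet points of a summand
remain Daugavet points of an `ℓ¹`-sum, and weak* Daugavet points of the dual of a summand remain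
such points in the dual of the sum, which is an `ℓ^∞`-sum. -/
theorem exists_equivNorm_of_generating {Q : X →L[ℝ] X} (hQ : ∀ x, Q (Q x) = Q x) {x₀ : X}
    {D : Set X} {p : StrongDual ℝ X} {G : Set (StrongDual ℝ X)}
    (hD : IsDaugavetGenerating Q.toLinearMap.ker x₀ D)
    (hG : IsWeakStarDaugavetGenerating Q.toLinearMap.range p G) :
    ∃ N : EquivNorm X, (∃ x : N.Space, IsDaugavetPoint x) ∧
      ∃ f : StrongDual ℝ N.Space, IsWeakStarDaugavetPoint f := by
  have hker : ∀ m, m ∈ Q.toLinearMap.ker ↔ Q m = 0 := fun m => LinearMap.mem_ker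
  have hran : ∀ y, y ∈ Q.toLinearMap.range ↔ Q y = y := fun y =>
    ⟨by rintro ⟨x, rfl⟩; exact hQ x, fun h => ⟨y, h⟩⟩
  set Q' : X →L[ℝ] X := ContinuousLinearMap.id ℝ X - Q with hQ'
  have hQ'a : ∀ x, Q' x = x - Q x := fun x => rfl
  have hQ'ker : ∀ x, Q' x ∈ Q.toLinearMap.ker := fun x => by simp [hker, hQ'a, hQ]
  set F₁ : Set (StrongDual ℝ X) := (fun f => f ∘L Q') '' {f | ∀ w ∈ D, |f w| ≤ 1}
  set F₂ : Set (StrongDual ℝ X) := (fun g => g ∘L Q) '' G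
  obtain ⟨C₁, hC₁⟩ := hD.norm_le
  obtain ⟨C₂, hC₂⟩ := hG.norm_le
  obtain ⟨R₁, hR₁⟩ := hD.bounded
  obtain ⟨R₂, hR₂⟩ := hG.bounded
  have hR₂0 : 0 ≤ R₂ := by
    obtain ⟨g, hg⟩ := hG.nonempty
    exact (norm_nonneg g).trans (hR₂ g hg)
  have hb₁ : ∀ f ∈ F₁, ∀ x, |f x| ≤ |C₁| * ‖Q'‖ * ‖x‖ := by
    rintro _ ⟨f, hf, rfl⟩ x
    refine (hC₁ f 1 hf _ (hQ'ker x)).trans ?_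
    rw [mul_one, mul_assoc]
    exact mul_le_mul (le_abs_self _) (Q'.le_opNorm x) (norm_nonneg _) (abs_nonneg _)
  have hb₂ : ∀ f ∈ F₂, ∀ x, |f x| ≤ R₂ * ‖Q‖ * ‖x‖ := by
    rintro _ ⟨g, hg, rfl⟩ x
    refine (g.le_opNorm _).trans ?_
    rw [mul_assoc]
    exact mul_le_mul (hR₂ g hg) (Q.le_opNorm x) (norm_nonneg _) hR₂0
  set p₁ := supSeminorm F₁ ⟨_, hb₁⟩
  set p₂ := supSeminorm F₂ ⟨_, hb₂⟩
  -- the basic properties of the two summands of the norm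
  have hp₁f : ∀ f : StrongDual ℝ X, (∀ w ∈ D, |f w| ≤ 1) → ∀ x, |f (Q' x)| ≤ p₁ x :=
    fun f hf x => le_supSeminorm ⟨_, hb₁⟩ ⟨f, hf, rfl⟩ x
  have hp₂g : ∀ g ∈ G, ∀ x, |g (Q x)| ≤ p₂ x :=
    fun g hg x => le_supSeminorm ⟨_, hb₂⟩ ⟨g, hg, rfl⟩ x
  have hp₁Q : ∀ y, p₁ (Q y) = 0 := fun y => le_antisymm
    (supSeminorm_le _ le_rfl (by rintro _ ⟨f, -, rfl⟩; simp [hQ'a, hQ])) (apply_nonneg _ _)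
  have hp₂m : ∀ m, Q m = 0 → p₂ m = 0 := fun m hm => le_antisymm
    (supSeminorm_le _ le_rfl (by rintro _ ⟨g, -, rfl⟩; simp [hm])) (apply_nonneg _ _)
  have hp₁eq : ∀ x, p₁ (Q' x) = p₁ x := fun x => by
    have h1 := map_sub_le_add p₁ x (Q x)
    have h2 := map_add_le_add p₁ (Q' x) (Q x)
    rw [hQ'a, sub_add_cancel, ← hQ'a] at h2
    rw [← hQ'a] at h1
    linarith [hp₁Q x]
  have hp₂eq : ∀ x, p₂ (Q x) = p₂ x := fun x => by
    have h1 := map_sub_le_add p₂ x (Q' x)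
    have h2 := map_add_le_add p₂ (Q x) (Q' x)
    rw [hQ'a, sub_sub_cancel, ← hQ'a] at h1
    rw [hQ'a, add_sub_cancel, ← hQ'a] at h2
    linarith [hp₂m _ ((hker _).1 (hQ'ker x))]
  have hp₁D : ∀ w ∈ D, p₁ w ≤ 1 := by
    intro w hw
    refine supSeminorm_le _ zero_le_one ?_
    rintro _ ⟨f, hf, rfl⟩
    have hQw := (hker w).1 (hD.subset hw)
    simpa [hQ'a, hQw] using hf w hw
  have hp₁scale : ∀ (f : StrongDual ℝ X) (s : ℝ), 0 < s → (∀ w ∈ D, |f w| ≤ s) →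
      ∀ x, |f (Q' x)| ≤ s * p₁ x := by
    intro f s hs hf x
    have := hp₁f (s⁻¹ • f) (fun w hw => by
      rw [smul_apply, smul_eq_mul, abs_mul, abs_of_pos (inv_pos.2 hs), inv_mul_le_iff₀ hs, mul_one]
      exact hf w hw) x
    rwa [smul_apply, smul_eq_mul, abs_mul, abs_of_pos (inv_pos.2 hs), inv_mul_le_iff₀ hs] at this
  have hlow₁ : ∀ x, ‖Q' x‖ ≤ (|R₁| + 1) * p₁ x := by
    intro x
    obtain ⟨f, hf, hfx⟩ := exists_dual_vector'' ℝ (Q' x)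
    have := hp₁scale f (|R₁| + 1) (by positivity) (fun w hw => by
      refine (f.le_opNorm w).trans ?_
      have := hR₁ w hw
      nlinarith [norm_nonneg w, norm_nonneg f, le_abs_self R₁]) x
    rw [hfx] at this
    simpa using this
  have hlow₂ : ∀ x, ‖Q x‖ ≤ |C₂| * p₂ x := fun x =>
    (hC₂ (Q x) (p₂ x) fun g hg => hp₂g g hg x).trans <|
      mul_le_mul_of_nonneg_right (le_abs_self _) (apply_nonneg _ _)
  let N : EquivNorm X :=
    { toSeminorm := p₁ + p₂
      equiv := by
        refine ⟨(|R₁| + 1 + |C₂|)⁻¹, |C₁| * ‖Q'‖ + R₂ * ‖Q‖ + 1, by positivity, by positivity,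
          fun x => ⟨?_, ?_⟩⟩
        · rw [inv_mul_le_iff₀ (by positivity), add_apply]
          have h1 : ‖x‖ ≤ ‖Q' x‖ + ‖Q x‖ := by
            simpa [hQ'a] using norm_add_le (Q' x) (Q x)
          have h2 := mul_nonneg (abs_nonneg C₂) (apply_nonneg p₁ x)
          have h3 := mul_nonneg (by positivity : 0 ≤ |R₁| + 1) (apply_nonneg p₂ x)
          linarith [hlow₁ x, hlow₂ x]
        · rw [add_apply]
          have h1 : p₁ x ≤ |C₁| * ‖Q'‖ * ‖x‖ :=
            supSeminorm_le _ (by positivity) fun f hf => hb₁ f hf x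
          have h2 : p₂ x ≤ R₂ * ‖Q‖ * ‖x‖ :=
            supSeminorm_le _ (by positivity) fun f hf => hb₂ f hf x
          linarith [norm_nonneg x] }
  have hN : ∀ x, N.toSeminorm x = p₁ x + p₂ x := fun x => rfl
  have hx₀ := (hker x₀).1 hD.mem
  have hx₀D : p₁ x₀ ≤ 1 := supSeminorm_le _ zero_le_one <| by
    rintro _ ⟨f, hf, rfl⟩
    simpa [hQ'a, hx₀] using hD.abs_le f 1 hf
  have hNx₀ : N.toSeminorm x₀ = 1 := by
    obtain ⟨w, hw⟩ := hD.nonempty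
    obtain ⟨ψ, h1, -, h3⟩ := hD.exists_pos w hw
    have := hp₁f ψ h3 x₀
    rw [hQ'a, hx₀, sub_zero, h1, abs_one] at this
    rw [hN, hp₂m x₀ hx₀]
    linarith
  -- points on which a test functional separates to distance `2`
  have hfar : ∀ (ψ : StrongDual ℝ X) (v : X), (∀ w ∈ D, |ψ w| ≤ 1) → Q v = 0 → ψ x₀ = 1 →
      ψ v = -1 → 2 ≤ N.toSeminorm (x₀ - v) := by
    intro ψ v hψ hv h1 h2
    have := hp₁f ψ hψ (x₀ - v)
    rw [hQ'a, map_sub Q, hx₀, hv, sub_zero, sub_zero, map_sub, h1, h2] at this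
    rw [hN]
    norm_num at this
    linarith [apply_nonneg p₂ (x₀ - v)]
  refine ⟨N, ⟨N.toSpace x₀, N.isDaugavetPoint_toSpace hNx₀ ?_⟩,
    ⟨N.toDual (p ∘L Q), N.isWeakStarDaugavetPoint_toDual ?_ ?_ ?_⟩⟩
  · rintro f hfN β hβ0 hβ1 ⟨v, hv⟩
    by_cases hw : ∃ w ∈ D, β < |f w|
    · obtain ⟨w, hw, hβw⟩ := hw
      have hQw := (hker w).1 (hD.subset hw)
      have hNw : N.toSeminorm w ≤ 1 := by
        rw [hN, hp₂m w hQw, add_zero]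
        exact hp₁D w hw
      rcases lt_abs.1 hβw with h | h
      · obtain ⟨ψ, h1, h2, h3⟩ := hD.exists_neg w hw
        exact ⟨w, hNw, h, by linarith [hfar ψ w h3 hQw h1 h2]⟩
      · obtain ⟨ψ, h1, h2, h3⟩ := hD.exists_pos w hw
        refine ⟨-w, by rwa [map_neg_eq_map], by rwa [map_neg], ?_⟩
        linarith [hfar ψ (-w) h3 (by simp [hQw]) h1 (by simp [h2])]
    · push Not at hw
      have h1 := hp₁scale f β hβ0 hw v
      have h2 : β * p₂ v < |f (Q v)| := by
        have : f v = f (Q' v) + f (Q v) := by rw [← map_add, hQ'a, sub_add_cancel]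
        have := abs_add_le (f (Q' v)) (f (Q v))
        rw [hN] at hv
        simp_all only
        linarith
      have hNQ : N.toSeminorm (Q v) = p₂ v := by rw [hN, hp₁Q, hp₂eq, zero_add]
      have h0 : 0 < p₂ v := by
        have := hfN (Q v)
        rw [hNQ] at this
        nlinarith [abs_nonneg (f (Q v)), apply_nonneg p₂ v]
      -- normalise `Q v`, with the sign making `f` positive
      obtain ⟨σ, hσ, hσf⟩ : ∃ σ : ℝ, |σ| = 1 ∧ σ * f (Q v) = |f (Q v)| := by
        rcases abs_choice (f (Q v)) with h | h
        · exact ⟨1, by simp, by rw [h, one_mul]⟩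
        · exact ⟨-1, by simp, by rw [h, neg_one_mul]⟩
      set y := ((p₂ v)⁻¹ * σ) • Q v with hy
      have hNy : N.toSeminorm y = 1 := by
        rw [hy, map_smul_eq_mul, hNQ, Real.norm_eq_abs, abs_mul, hσ, abs_of_pos (inv_pos.2 h0),
          mul_one, inv_mul_cancel₀ h0.ne']
      refine ⟨y, hNy.le, ?_, ?_⟩
      · rw [hy, map_smul, smul_eq_mul, mul_assoc, hσf, lt_inv_mul_iff₀ h0, mul_comm]
        exact h2
      · have hQy : Q y = y := by rw [hy, map_smul, hQ]
        have e1 : p₁ (x₀ - y) = p₁ x₀ := by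
          rw [← hp₁eq, hQ'a, map_sub Q, hx₀, hQy]
          congr 1
          abel
        have e2 : p₂ (x₀ - y) = p₂ y := by
          rw [← hp₂eq, map_sub, hx₀, hQy, zero_sub, map_neg_eq_map]
        have e3 : p₁ y = 0 := by rw [← hQy, hp₁Q]
        rw [hN, hp₂m x₀ hx₀] at hNx₀
        rw [hN, e3] at hNy
        rw [hN, e1, e2]
        linarith
  · intro y
    rw [hN, ContinuousLinearMap.comp_apply]
    have := hG.abs_le (Q y) (p₂ y) fun g hg => hp₂g g hg y
    linarith [apply_nonneg p₁ y]
  all_goals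
    have hNz : ∀ z, Q z = z → (∀ g ∈ G, |g z| ≤ 1) → N.toSeminorm z ≤ 1 := by
      intro z hz h
      have h1 : p₁ z = 0 := by rw [← hz, hp₁Q]
      rw [hN, h1, zero_add]
      refine supSeminorm_le _ zero_le_one ?_
      rintro _ ⟨g, hg, rfl⟩
      simpa [hz] using h g hg
  · obtain ⟨g, hg⟩ := hG.nonempty
    obtain ⟨z, hz, h1, -, h3⟩ := hG.exists_pos g hg
    have hQz := (hran z).1 hz
    exact ⟨z, hNz z hQz h3, by simpa [hQz] using h1⟩
  · intro x hx β hβ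
    rw [hN] at hx
    obtain ⟨_, ⟨f, hf, rfl⟩, hfx⟩ := exists_lt_of_lt_supSeminorm (F := F₁) ⟨_, hb₁⟩
      ⟨_, 0, by simp, rfl⟩ (show p₁ x - (1 - β) / 2 < p₁ x by linarith)
    obtain ⟨_, ⟨g, hg, rfl⟩, hgx⟩ := exists_lt_of_lt_supSeminorm (F := F₂) ⟨_, hb₂⟩
      (hG.nonempty.image _) (show p₂ x - (1 - β) / 2 < p₂ x by linarith)
    rw [ContinuousLinearMap.comp_apply] at hfx hgx
    -- both functionals may be replaced by their negatives
    obtain ⟨f', hf', hf'x⟩ : ∃ f' : StrongDual ℝ X,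
        (∀ w ∈ D, |f' w| ≤ 1) ∧ f' (Q' x) = |f (Q' x)| := by
      rcases abs_choice (f (Q' x)) with h | h
      · exact ⟨f, hf, h.symm⟩
      · exact ⟨-f, fun w hw => by simpa using hf w hw, by simp [h]⟩
    obtain ⟨g', hg', hg'x, z, hz, h1, h2, h3⟩ : ∃ g' : StrongDual ℝ X,
        (∀ y, |g' (Q y)| ≤ p₂ y) ∧ g' (Q x) = |g (Q x)| ∧
          ∃ z ∈ Q.toLinearMap.range, p z = 1 ∧ g' z = -1 ∧ ∀ k ∈ G, |k z| ≤ 1 := by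
      rcases abs_choice (g (Q x)) with h | h
      · exact ⟨g, hp₂g g hg, h.symm, hG.exists_neg g hg⟩
      · obtain ⟨z, hz, h1, h2, h3⟩ := hG.exists_pos g hg
        exact ⟨-g, fun y => by simpa using hp₂g g hg y, by simp [h], z, hz, h1, by simp [h2], h3⟩
    have hQz := (hran z).1 hz
    refine ⟨f' ∘L Q' + g' ∘L Q, fun y => ?_, ?_, z, hNz z hQz h3, ?_⟩
    · exact (abs_add_le _ _).trans (add_le_add (hp₁f f' hf' y) (hg' y))
    · rw [add_apply, ContinuousLinearMap.comp_apply, ContinuousLinearMap.comp_apply, hf'x, hg'x]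
      linarith
    · simp [hQ'a, hQz, h1, h2]
      norm_num

end

theorem theorem1p3 {X : Type u} [NormedAddCommGroup X] [NormedSpace ℝ X] [CompleteSpace X]
    (hdim : ¬ FiniteDimensional ℝ X)
    (hX : ∃ e : ℕ → X, IsUnconditionalBasicSequence e ∧
      (Submodule.span ℝ (Set.range e)).topologicalClosure.ClosedComplemented) :
    ∃ N : EquivNorm X,
      (∃ x : N.Space, IsDaugavetPoint x) ∧
      ∃ f : StrongDual ℝ N.Space, IsWeakStarDaugavetPoint f := by
  obtain ⟨e, he, hc⟩ := hX
  obtain ⟨S⟩ := he.nonempty_unconditionalSystem hc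
  -- the even part of the system serves the Daugavet point, the odd part the weak* Daugavet point
  set Q := S.P {n | Odd n}
  obtain ⟨D, hD⟩ := (S.comp (fun n => 2 * n) fun m n h => by simpa using h).exists_isDaugavetGenerating
    (M := Q.toLinearMap.ker)
    (fun n => S.P_e_of_notMem (by simp))
    (fun A u hu => by
      refine (S.P_eq_of_indicator_eq (B := ∅) (y := 0) fun n => ?_).trans (map_zero _)
      change {n | Odd n}.indicator (fun n => S.c n (S.P ((fun n => 2 * n) '' A) u)) n = _
      by_cases hn : Odd n
      · have : n ∉ (fun n => 2 * n) '' A := by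
          rintro ⟨m, -, rfl⟩
          exact Nat.not_odd_iff_even.2 (even_two_mul m) hn
        simp [hn, S.c_P, Set.indicator_of_notMem this]
      · simp [hn])
  obtain ⟨G, hG⟩ := (S.comp (fun n => 2 * n + 1)
    fun m n h => by simpa using h).exists_isWeakStarDaugavetGenerating
    (M := Q.toLinearMap.range)
    (fun n => ⟨_, S.P_e_of_mem (by simp)⟩)
  exact exists_equivNorm_of_generating (S.P_P_self _) hD hG
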